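/- Let $n,m\ge 1$, let $A_1,\dots,A_m\in\mathbb R^{n\times n}$, let $\mathcal A(M)=(\langle A_1,M\rangle,\dots,\langle A_m,M\rangle)^\top$ with $\langle A,B\rangle=\operatorname{tr}(A^\top B)$, and let $\mathbf A=[\operatorname{vec}(A_1),\dots,\operatorname{vec}(A_m)]^\top\in\mathbb R^{m\times n^2}$. Let $r\ge r^*\ge 1$ be integers and let $M^*\in\mathbb R^{n\times n}$ be symmetric positive semidefinite with $\operatorname{rank}(M^*)=r^*$. Suppose that $\mathcal A$ satisfies the $(\delta,r+r^*)$-restricted isometry property, that is, $\delta\in[0,1)$ and $$(1-\delta)\|M\|_F^2\le\|\mathcal A(M)\|^2\le(1+\delta)\|M\|_F^2\quad\text{for all } M\in\mathbb R^{n\times n}\text{ with }\operatorname{rank}(M)\le r+r^*,$$ and that $\delta<1/(1+\sqrt{r^*/r})$. For $w\in\mathbb R^m$ put $$f_w(X)=\tfrac12\|\mathcal A(XX^\top)-\mathcal A(M^*)+w\|^2,\qquad X\in\mathbb R^{n\times r},$$ and let $\sigma_r(X)$ be the $r$-th largest singular value of $X$ ($0$ if $r>n$). Let $\epsilon>0$.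 If $w\in\mathbb R^m$ satisfies $\|\mathbf A^\top w\|\le\epsilon$, then every second-order critical point $\hat X\in\mathbb R^{n\times r}$ of $f_w$ (that is, $\nabla f_w(\hat X)=0$ and $\nabla^2 f_w(\hat X)\succeq 0$; in particular every local minimizer) satisfies the following. If $\sigma_r(\hat X)\le\sqrt{\epsilon/(1+\delta)}$, then $$\|\hat X\hat X^\top-M^*\|_F\le\frac{\epsilon\sqrt r+\sqrt{\epsilon^2r+16(1-\delta)\epsilon\sqrt r\,\|M^*\|_F}}{2(1-\delta)},$$ and if $\sigma_r(\hat X)>\sqrt{\epsilon/(1+\delta)}$, then $$\Bigl(\frac{1-\delta}{1+\delta}-\frac{\sqrt{r^*/r}}{2+\sqrt{r^*/r}}\Bigr)\|\hat X\hat X^\top-M^*\|_F\le 2\epsilon\sqrt{r^*}+2\sqrt{2\epsilon(1+\delta)}\,\bigl(\|\hat X\hat X^\top-M^*\|_F^{1/2}+\|M^*\|_F^{1/2}\bigr).$$ Consequently, if $w$ is a random vector in $\mathbb R^m$, then with probability at least $\mathbb P(\|\mathbf A^\top w\|\le\epsilon)$ these two implications hold simultaneously for all second-order critical points $\hat X$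 of $f_w$. -/

import Mathlib

open scoped Matrix.Norms.Frobenius
open MeasureTheory

namespace MatrixSensing

noncomputable section

/-- The linear measurement operator `𝒜(M) = (⟨A₁, M⟩, …, ⟨Aₘ, M⟩)` with `⟨A, B⟩ = tr(Aᵀ B)`;
its values carry the Euclidean norm. -/
def measurement {n m : ℕ} (A : Fin m → Matrix (Fin n) (Fin n) ℝ) (M : Matrix (Fin n) (Fin n) ℝ) :
    EuclideanSpace ℝ (Fin m) :=
  WithLp.toLp 2 fun i => ((A i).transpose * M).trace

/-- The matrix representation of the measurement operator: its rows are `vec(A₁), …, vec(Aₘ)`. -/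
def measureMatrix {n m : ℕ} (A : Fin m → Matrix (Fin n) (Fin n) ℝ) :
    Matrix (Fin m) (Fin n × Fin n) ℝ :=
  Matrix.of fun i => (A i).vec

/-- The back-projected noise `𝐀ᵀ w`, a vector with the Euclidean norm. -/
def backProjection {n m : ℕ} (A : Fin m → Matrix (Fin n) (Fin n) ℝ)
    (w : EuclideanSpace ℝ (Fin m)) : EuclideanSpace ℝ (Fin n × Fin n) :=
  WithLp.toLp 2 ((measureMatrix A).transpose.mulVec w.ofLp)

/-- The `(δ, g)`-restricted isometry property (matrix norms are Frobenius norms). -/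
def RIP {n m : ℕ} (A : Fin m → Matrix (Fin n) (Fin n) ℝ) (δ : ℝ) (g : ℕ) : Prop :=
  0 ≤ δ ∧ δ < 1 ∧ ∀ M : Matrix (Fin n) (Fin n) ℝ, M.rank ≤ g →
    (1 - δ) * ‖M‖ ^ 2 ≤ ‖measurement A M‖ ^ 2 ∧ ‖measurement A M‖ ^ 2 ≤ (1 + δ) * ‖M‖ ^ 2

/-- The factorized objective `f(X) = ½ ‖𝒜(X Xᵀ) - b + w‖²` with `b = 𝒜(M⋆)`. -/
def objective {n m r : ℕ} (A : Fin m → Matrix (Fin n) (Fin n) ℝ)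
    (Mstar : Matrix (Fin n) (Fin n) ℝ) (w : EuclideanSpace ℝ (Fin m))
    (X : Matrix (Fin n) (Fin r) ℝ) : ℝ :=
  1 / 2 * ‖measurement A (X * X.transpose) - measurement A Mstar + w‖ ^ 2

/-- The gradient of a function of an `n × r` matrix: the matrix of its partial derivatives. -/
def matrixGradient {n r : ℕ} (f : Matrix (Fin n) (Fin r) ℝ → ℝ) (X : Matrix (Fin n) (Fin r) ℝ) :
    Matrix (Fin n) (Fin r) ℝ :=
  Matrix.of fun i j => fderiv ℝ f X (Matrix.single i j 1)

/-- The Hessian of a function of an `n × r` matrix: the `nr × nr` matrix of its second partial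
derivatives. -/
def matrixHessian {n r : ℕ} (f : Matrix (Fin n) (Fin r) ℝ → ℝ) (X : Matrix (Fin n) (Fin r) ℝ) :
    Matrix (Fin n × Fin r) (Fin n × Fin r) ℝ :=
  Matrix.of fun p q =>
    fderiv ℝ (fun Y => fderiv ℝ f Y (Matrix.single q.1 q.2 1)) X (Matrix.single p.1 p.2 1)

/-- Second-order critical points: the gradient vanishes and the Hessian is positive
semidefinite. -/
def IsSecondOrderCritical {n r : ℕ} (f : Matrix (Fin n) (Fin r) ℝ → ℝ)
    (X : Matrix (Fin n) (Fin r) ℝ) : Prop :=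
  ‖matrixGradient f X‖ = 0 ∧ (matrixHessian f X).PosSemidef

/-- `sigma X k` is the `k`-th largest singular value `σ_k(X)`, for `k ≥ 1`. Mathlib numbers
singular values from `0`; those beyond `min(n, r)` are `0`. -/
def sigma {n r : ℕ} (X : Matrix (Fin n) (Fin r) ℝ) (k : ℕ) : ℝ :=
  (Matrix.toEuclideanLin X).singularValues (k - 1)

/-- The two error bounds for the point `X`: an explicit one if `σ_r(X)` is small, and a quadratic
inequality in `‖X Xᵀ - M⋆‖_F ^ (1/2)` if it is not. -/
def ErrorBounds {n r : ℕ} (Mstar : Matrix (Fin n) (Fin n) ℝ) (rstar : ℕ) (δ ε : ℝ)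
    (X : Matrix (Fin n) (Fin r) ℝ) : Prop :=
  (sigma X r ≤ √(ε / (1 + δ)) →
    ‖X * X.transpose - Mstar‖ ≤
      (ε * √(r : ℝ) + √(ε ^ 2 * (r : ℝ) + 16 * (1 - δ) * ε * √(r : ℝ) * ‖Mstar‖))
        / (2 * (1 - δ))) ∧
  (√(ε / (1 + δ)) < sigma X r →
    ((1 - δ) / (1 + δ) - √((rstar : ℝ) / (r : ℝ)) / (2 + √((rstar : ℝ) / (r : ℝ))))
        * ‖X * X.transpose - Mstar‖ ≤
      2 * ε * √(rstar : ℝ)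
        + 2 * √(2 * ε * (1 + δ)) * (√‖X * X.transpose - Mstar‖ + √‖Mstar‖))

end

end MatrixSensing

namespace MatrixSensing

/-! Put E = XXᵀ − M⋆, ρ = 𝒜(E) + w, σ = σ_r(X), t = √(r⋆/r). The gradient condition makes ρ
orthogonal to every 𝒜(XVᵀ + VXᵀ). The Hessian tested on uvᵀ, with v a unit right singular vector for
σ, gives ⟨ρ, 𝒜(uuᵀ)⟩ ≥ −(1+δ)(σ²|u|² + ⟨Xv,u⟩²) (`IsSecondOrderCritical.curvature`).

Small σ: write M⋆ = ZZᵀ and sum this over the columns of Z. Then ⟨ρ, 𝒜(E)⟩ ≤ 2ε tr M⋆, while RIP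
gives ⟨ρ, 𝒜(E)⟩ ≥ (1−δ)‖E‖² − ε‖E‖: a quadratic inequality in ‖E‖.

Positive σ: X has full column rank, so M⋆ = (XR+Y)(XR+Y)ᵀ with XᵀY = 0, and E = N − W with W = YYᵀ
normal and N = XVᵀ + VXᵀ tangent. Pair ρ with 𝒜(N − yW), y ≥ 0: the gradient removes N, curvature
costs at most y(1+δ)σ² tr W, and polarized RIP compares the rest with ⟨E, N − yW⟩. The key estimate
is `normal_part_bound`: σ² tr W ≤ t‖W‖‖N‖ if σ² tr W ≤ ‖W‖². Indeed RRᵀ has rank at most r⋆ < or =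
r, so it cannot cancel the identity in X(1−RRᵀ)Xᵀ in the remaining directions, and where it does
cancel, the cross block XRYᵀ is large. Optimizing y (`residual_le_of_test_family`) yields (1/(1+t) −
δ)‖E‖ ≤ ε, which implies the second bound. -/

/-! ### Frobenius geometry and the measurement operator -/

lemma frobenius_sq {α β : Type*} [Fintype α] [Fintype β] (M : Matrix α β ℝ) :
    ‖M‖ ^ 2 = ∑ i, ∑ j, M i j ^ 2 := by
  rw [Matrix.frobenius_norm_def, ← Real.sqrt_eq_rpow, Real.sq_sqrt (by positivity)]
  simp

lemma trace_transpose_mul {α β : Type*} [Fintype α] [Fintype β] (M N : Matrix α β ℝ) :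
    (M.transpose * N).trace = ∑ i, ∑ j, M i j * N i j := by
  simp only [Matrix.trace, Matrix.diag, Matrix.mul_apply, Matrix.transpose_apply]
  exact Finset.sum_comm

lemma frobenius_sq_eq_trace {α β : Type*} [Fintype α] [Fintype β] (M : Matrix α β ℝ) :
    ‖M‖ ^ 2 = (M.transpose * M).trace := by
  rw [frobenius_sq, trace_transpose_mul]
  simp [sq]

lemma frobenius_sq_add_smul {α β : Type*} [Fintype α] [Fintype β] (M N : Matrix α β ℝ) (a b : ℝ) :
    ‖a • M + b • N‖ ^ 2 =
      a ^ 2 * ‖M‖ ^ 2 + 2 * (a * b) * (M.transpose * N).trace + b ^ 2 * ‖N‖ ^ 2 := by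
  simp only [frobenius_sq, trace_transpose_mul, Finset.mul_sum, ← Finset.sum_add_distrib]
  refine Finset.sum_congr rfl fun i _ => Finset.sum_congr rfl fun j _ => ?_
  simp only [Matrix.add_apply, Matrix.smul_apply, smul_eq_mul]
  ring

/-- The measurement operator as a linear map. -/
noncomputable def measurementLin {n m : ℕ} (A : Fin m → Matrix (Fin n) (Fin n) ℝ) :
    Matrix (Fin n) (Fin n) ℝ →ₗ[ℝ] EuclideanSpace ℝ (Fin m) where
  toFun := measurement A
  map_add' M N := by
    ext i
    simp [measurement, Matrix.mul_add]
  map_smul' c M := by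
    ext i
    simp [measurement]

lemma measurementLin_apply {n m : ℕ} (A : Fin m → Matrix (Fin n) (Fin n) ℝ)
    (M : Matrix (Fin n) (Fin n) ℝ) : measurementLin A M = measurement A M := rfl

/-- Cauchy–Schwarz after moving 𝒜 to the other side: ⟨w, 𝒜(N)⟩ = ⟨𝐀ᵀw, vec N⟩. This is how the noise
bound enters both cases. -/
lemma abs_inner_measurement_le {n m : ℕ} (A : Fin m → Matrix (Fin n) (Fin n) ℝ)
    (w : EuclideanSpace ℝ (Fin m)) (N : Matrix (Fin n) (Fin n) ℝ) :
    |inner ℝ w (measurementLin A N)| ≤ ‖backProjection A w‖ * ‖N‖ := by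
  have hinner : inner ℝ w (measurementLin A N) =
      inner ℝ (backProjection A w) (WithLp.toLp 2 N.vec : EuclideanSpace ℝ (Fin n × Fin n)) := by
    have htrace (M : Matrix (Fin n) (Fin n) ℝ) :
        (M.transpose * N).trace = ∑ p, M.vec p * N.vec p := by
      rw [trace_transpose_mul, Fintype.sum_prod_type, Finset.sum_comm]
      rfl
    simp only [measurementLin_apply, measurement, backProjection, PiLp.inner_apply, htrace,
      Matrix.mulVec, dotProduct, measureMatrix, Matrix.transpose_apply, Matrix.of_apply,
      RCLike.inner_apply, conj_trivial, Finset.mul_sum, Finset.sum_mul]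
    rw [Finset.sum_comm]
    exact Finset.sum_congr rfl fun p _ => Finset.sum_congr rfl fun i _ => by ring
  have hnorm : ‖(WithLp.toLp 2 N.vec : EuclideanSpace ℝ (Fin n × Fin n))‖ = ‖N‖ := by
    rw [← sq_eq_sq₀ (norm_nonneg _) (norm_nonneg _), EuclideanSpace.norm_sq_eq, frobenius_sq,
      Fintype.sum_prod_type, Finset.sum_comm]
    simp [Matrix.vec]
  rw [hinner, ← hnorm]
  exact abs_real_inner_le_norm _ _

/-- Polarization of the restricted isometry property on a pencil of low-rank matrices. -/
lemma RIP.inner_ge {n m : ℕ} {A : Fin m → Matrix (Fin n) (Fin n) ℝ} {δ : ℝ} {g : ℕ}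
    (h : RIP A δ g) (E F : Matrix (Fin n) (Fin n) ℝ)
    (hrank : ∀ a b : ℝ, (a • E + b • F).rank ≤ g) :
    (E.transpose * F).trace - δ * (‖E‖ * ‖F‖) ≤
      inner ℝ (measurementLin A E) (measurementLin A F) := by
  rcases (norm_nonneg E).eq_or_lt with hE | hE
  · have : E = 0 := norm_eq_zero.1 hE.symm
    simp [this]
  rcases (norm_nonneg F).eq_or_lt with hF | hF
  · have : F = 0 := norm_eq_zero.1 hF.symm
    simp [this]
  -- The weights give both matrices equal norm, so the RIP loss is the product ‖E‖‖F‖ instead of a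
  -- mean of squares.
  have h1 := (h.2.2 _ (hrank ‖F‖ ‖E‖)).1
  have h2 := (h.2.2 _ (hrank ‖F‖ (-‖E‖))).2
  rw [frobenius_sq_add_smul, ← measurementLin_apply, map_add, map_smul, map_smul,
    norm_add_sq_real, norm_smul, norm_smul, inner_smul_left, inner_smul_right] at h1 h2
  simp only [Real.norm_eq_abs, mul_pow, sq_abs, conj_trivial, neg_sq] at h1 h2
  have hEF : 0 < ‖E‖ * ‖F‖ := mul_pos hE hF
  refine le_of_mul_le_mul_left ?_ hEF
  linarith

/-! ### Derivatives of the objective and the second-order conditions -/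

section Derivatives

variable {V W : Type*} [NormedAddCommGroup V] [NormedSpace ℝ V]
  [NormedAddCommGroup W] [InnerProductSpace ℝ W]

lemma fderiv_half_norm_sq_bilin (B : V →L[ℝ] V →L[ℝ] W) (c : W) (X U : V) :
    fderiv ℝ (fun Y => 1 / 2 * ‖B Y Y + c‖ ^ 2) X U = inner ℝ (B X X + c) (B X U + B U X) := by
  have hB := (B.hasFDerivAt_of_bilinear (hasFDerivAt_id X) (hasFDerivAt_id X)).add_const c
  have h := (hB.norm_sq).const_mul (1 / 2)
  simp only [id] at h
  rw [h.fderiv]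
  simp [inner_add_right, inner_add_left]

lemma fderiv_fderiv_half_norm_sq_bilin (B : V →L[ℝ] V →L[ℝ] W) (c : W) (X S T : V) :
    fderiv ℝ (fun Y => fderiv ℝ (fun Y => 1 / 2 * ‖B Y Y + c‖ ^ 2) Y S) X T =
      inner ℝ (B X S + B S X) (B X T + B T X) + inner ℝ (B X X + c) (B S T + B T S) := by
  simp only [fderiv_half_norm_sq_bilin]
  have hB := (B.hasFDerivAt_of_bilinear (hasFDerivAt_id X) (hasFDerivAt_id X)).add_const c
  have hS : HasFDerivAt (fun Y => B Y S + B S Y) (B.flip S + B S) X :=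
    (B.flip S).hasFDerivAt.add (B S).hasFDerivAt
  have h := hB.inner ℝ hS
  simp only [id] at h
  rw [h.fderiv]
  have hT : (((ContinuousLinearMap.precompR V B) X) (ContinuousLinearMap.id ℝ V) +
      ((ContinuousLinearMap.precompL V B) (ContinuousLinearMap.id ℝ V)) X) T = B X T + B T X := by
    simp
  rw [ContinuousLinearMap.comp_apply, ContinuousLinearMap.prod_apply, fderivInnerCLM_apply, hT,
    real_inner_comm (B X S + B S X), add_apply, ContinuousLinearMap.flip_apply, add_comm,
    add_comm (B T S)]

lemma sum_fderiv_fderiv_half_norm_sq_bilin {ι : Type*} [Fintype ι] (B : V →L[ℝ] V →L[ℝ] W)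
    (c : W) (X : V) (e : ι → V) (u : ι → ℝ) (U : V) (hU : U = ∑ p, u p • e p) :
    ∑ p, u p * ∑ q, fderiv ℝ (fun Y => fderiv ℝ (fun Y => 1 / 2 * ‖B Y Y + c‖ ^ 2) Y (e q)) X (e p)
        * u q =
      ‖B X U + B U X‖ ^ 2 + 2 * inner ℝ (B X X + c) (B U U) := by
  -- Written with symmetrized forms, the right side is linear in each `U` and expands over the same
  -- double sum as the Hessian.
  have hsum : ‖B X U + B U X‖ ^ 2 + 2 * inner ℝ (B X X + c) (B U U) =
      inner ℝ ((B X + B.flip X) U) ((B X + B.flip X) U) +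
        inner ℝ (B X X + c) ((B + B.flip) U U) := by
    rw [real_inner_self_eq_norm_sq]
    simp [two_mul, inner_add_right]
  rw [hsum]
  conv_rhs => rw [hU]
  simp only [map_sum, map_smul, sum_inner, inner_sum, inner_smul_left, inner_smul_right,
    sum_apply, smul_apply, conj_trivial]
  simp only [Finset.mul_sum]
  conv_rhs => enter [2]; rw [Finset.sum_comm]
  simp only [← Finset.sum_add_distrib]
  refine Finset.sum_congr rfl fun p _ => Finset.sum_congr rfl fun q _ => ?_
  rw [fderiv_fderiv_half_norm_sq_bilin]
  simp only [add_apply, ContinuousLinearMap.flip_apply]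
  rw [add_comm (B (e q) (e p))]
  ring

end Derivatives

/-- The bilinear map `(X, Y) ↦ 𝒜(X Yᵀ)`. -/
noncomputable def factorBilin {n m : ℕ} (r : ℕ) (A : Fin m → Matrix (Fin n) (Fin n) ℝ) :
    Matrix (Fin n) (Fin r) ℝ →L[ℝ] Matrix (Fin n) (Fin r) ℝ →L[ℝ] EuclideanSpace ℝ (Fin m) :=
  (LinearMap.mk₂ ℝ (fun X Y => measurementLin A (X * Y.transpose))
    (fun X X' Y => by rw [Matrix.add_mul, map_add])
    (fun c X Y => by rw [Matrix.smul_mul, map_smul])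
    (fun X Y Y' => by rw [Matrix.transpose_add, Matrix.mul_add, map_add])
    (fun c X Y => by rw [Matrix.transpose_smul, Matrix.mul_smul, map_smul])).toContinuousBilinearMap

lemma factorBilin_apply {n m r : ℕ} (A : Fin m → Matrix (Fin n) (Fin n) ℝ)
    (X Y : Matrix (Fin n) (Fin r) ℝ) :
    factorBilin r A X Y = measurementLin A (X * Y.transpose) := rfl

lemma objective_eq {n m r : ℕ} (A : Fin m → Matrix (Fin n) (Fin n) ℝ)
    (Mstar : Matrix (Fin n) (Fin n) ℝ) (w : EuclideanSpace ℝ (Fin m)) :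
    objective (r := r) A Mstar w =
      fun X => 1 / 2 * ‖factorBilin r A X X + (w - measurementLin A Mstar)‖ ^ 2 := by
  funext X
  rw [objective, factorBilin_apply, measurementLin_apply, measurementLin_apply]
  congr 3
  abel

lemma residual_eq {n m r : ℕ} (A : Fin m → Matrix (Fin n) (Fin n) ℝ)
    (Mstar : Matrix (Fin n) (Fin n) ℝ) (w : EuclideanSpace ℝ (Fin m))
    (X : Matrix (Fin n) (Fin r) ℝ) :
    factorBilin r A X X + (w - measurementLin A Mstar) =
      measurementLin A (X * X.transpose - Mstar) + w := by
  rw [factorBilin_apply, map_sub]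
  abel

lemma eq_sum_single {n r : ℕ} (U : Matrix (Fin n) (Fin r) ℝ) :
    U = ∑ p : Fin n × Fin r, U p.1 p.2 • Matrix.single p.1 p.2 (1 : ℝ) := by
  conv_lhs => rw [Matrix.matrix_eq_sum_single U]
  rw [Fintype.sum_prod_type]
  simp [Matrix.smul_single]

lemma IsSecondOrderCritical.gradient_eq {n m r : ℕ} {A : Fin m → Matrix (Fin n) (Fin n) ℝ}
    {Mstar : Matrix (Fin n) (Fin n) ℝ} {w : EuclideanSpace ℝ (Fin m)}
    {X : Matrix (Fin n) (Fin r) ℝ} (h : IsSecondOrderCritical (objective A Mstar w) X)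
    (U : Matrix (Fin n) (Fin r) ℝ) :
    inner ℝ (measurementLin A (X * X.transpose - Mstar) + w)
      (measurementLin A (X * U.transpose + U * X.transpose)) = 0 := by
  have h0 : ∀ i j, fderiv ℝ (objective A Mstar w) X (Matrix.single i j 1) = 0 := fun i j =>
    Matrix.ext_iff.2 (norm_eq_zero.1 h.1) i j
  have hU : fderiv ℝ (objective A Mstar w) X U = 0 := by
    conv_lhs => rw [eq_sum_single U]
    simp only [map_sum, map_smul, h0, smul_zero, Finset.sum_const_zero]
  rw [map_add, ← residual_eq]
  refine Eq.trans ?_ hU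
  rw [objective_eq]
  exact (fderiv_half_norm_sq_bilin (factorBilin r A) _ X U).symm

lemma IsSecondOrderCritical.hessian_nonneg {n m r : ℕ} {A : Fin m → Matrix (Fin n) (Fin n) ℝ}
    {Mstar : Matrix (Fin n) (Fin n) ℝ} {w : EuclideanSpace ℝ (Fin m)}
    {X : Matrix (Fin n) (Fin r) ℝ} (h : IsSecondOrderCritical (objective A Mstar w) X)
    (U : Matrix (Fin n) (Fin r) ℝ) :
    0 ≤ ‖measurementLin A (X * U.transpose + U * X.transpose)‖ ^ 2 +
      2 * inner ℝ (measurementLin A (X * X.transpose - Mstar) + w)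
        (measurementLin A (U * U.transpose)) := by
  have hpos := h.2.dotProduct_mulVec_nonneg fun p => U p.1 p.2
  have hsum := sum_fderiv_fderiv_half_norm_sq_bilin (factorBilin r A) (w - measurementLin A Mstar)
    X (fun p : Fin n × Fin r => Matrix.single p.1 p.2 1) (fun p => U p.1 p.2) U (eq_sum_single U)
  rw [map_add, ← residual_eq]
  refine le_of_le_of_eq ?_ hsum
  rw [objective_eq] at hpos
  exact hpos

/-! ### Eigenvalue inequalities -/

section Spectral

variable {κ : Type*} [Fintype κ] [DecidableEq κ]

lemma exists_orthogonal_diagonalization {S : Matrix κ κ ℝ} (hS : S.IsHermitian) :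
    ∃ U : Matrix κ κ ℝ, U.transpose * U = 1 ∧ U * U.transpose = 1 ∧
      S = U * Matrix.diagonal hS.eigenvalues * U.transpose := by
  have h1 := Unitary.coe_star_mul_self hS.eigenvectorUnitary
  have h2 := Unitary.coe_mul_star_self hS.eigenvectorUnitary
  rw [Unitary.coe_star] at h2
  rw [Matrix.star_eq_conjTranspose, Matrix.conjTranspose_eq_transpose_of_trivial] at h1 h2
  refine ⟨hS.eigenvectorUnitary, h1, h2, ?_⟩
  have h := hS.spectral_theorem
  rw [Unitary.conjStarAlgAut_apply, Matrix.star_eq_conjTranspose,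
    Matrix.conjTranspose_eq_transpose_of_trivial] at h
  simpa using h

lemma orthogonal_diagonal_conj_apply (U : Matrix κ κ ℝ) (d : κ → ℝ) (i : κ) :
    (U * Matrix.diagonal d * U.transpose) i i = ∑ j, U i j ^ 2 * d j := by
  rw [Matrix.mul_apply]
  simp only [Matrix.mul_diagonal, Matrix.transpose_apply]
  exact Finset.sum_congr rfl fun j _ => by ring

/-- Diagonal entries of a symmetric matrix are majorized by its eigenvalues. -/
lemma sum_convex_diag_le {φ : ℝ → ℝ} (hφ : ConvexOn ℝ Set.univ φ) {S : Matrix κ κ ℝ}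
    (hS : S.IsHermitian) : ∑ i, φ (S i i) ≤ ∑ j, φ (hS.eigenvalues j) := by
  obtain ⟨U, hU1, hU2, hSU⟩ := exists_orthogonal_diagonalization hS
  -- The squares `U i j ^ 2` form a doubly stochastic matrix: rows feed Jensen, columns collapse the
  -- exchanged sum.
  have hrow (i : κ) : ∑ j, U i j ^ 2 = 1 := by
    have := congrFun (congrFun hU2 i) i
    simpa [Matrix.mul_apply, sq] using this
  have hcol (j : κ) : ∑ i, U i j ^ 2 = 1 := by
    have := congrFun (congrFun hU1 j) j
    simpa [Matrix.mul_apply, sq] using this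
  have hdiag (i : κ) : S i i = ∑ j, U i j ^ 2 * hS.eigenvalues j := by
    rw [← orthogonal_diagonal_conj_apply, ← hSU]
  calc ∑ i, φ (S i i) ≤ ∑ i, ∑ j, U i j ^ 2 * φ (hS.eigenvalues j) := by
        refine Finset.sum_le_sum fun i _ => ?_
        rw [hdiag]
        exact hφ.map_sum_le (fun j _ => sq_nonneg _) (hrow i) (fun _ _ => Set.mem_univ _)
    _ = ∑ j, φ (hS.eigenvalues j) := by
        rw [Finset.sum_comm]
        simp [← Finset.sum_mul, hcol]

lemma frobenius_sq_orthogonal_conj {U : Matrix κ κ ℝ} (hU : U * U.transpose = 1)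
    (M : Matrix κ κ ℝ) : ‖U.transpose * M * U‖ ^ 2 = ‖M‖ ^ 2 := by
  rw [frobenius_sq_eq_trace, frobenius_sq_eq_trace]
  calc ((U.transpose * M * U).transpose * (U.transpose * M * U)).trace
      = (U.transpose * (M.transpose * (U * U.transpose) * M * U)).trace := by
        simp only [Matrix.transpose_mul, Matrix.transpose_transpose, Matrix.mul_assoc]
    _ = (M.transpose * M).trace := by
        rw [Matrix.trace_mul_comm, hU, Matrix.mul_assoc _ U, hU]
        simp

lemma sum_sq_diag_le (M : Matrix κ κ ℝ) : ∑ j, M j j ^ 2 ≤ ‖M‖ ^ 2 := by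
  rw [frobenius_sq]
  exact Finset.sum_le_sum fun j _ =>
    Finset.single_le_sum (f := fun k => M j k ^ 2) (fun _ _ => sq_nonneg _) (Finset.mem_univ j)

/-- If `C ⪰ μ I` then `‖C - S‖²` is at least the squared norm of the positive part of
`μ I - S`. -/
lemma sum_posPart_eigenvalues_le {C S : Matrix κ κ ℝ} (hS : S.IsHermitian) {μ : ℝ}
    (hC : ∀ x : κ → ℝ, μ * (x ⬝ᵥ x) ≤ x ⬝ᵥ C.mulVec x) :
    ∑ j, max (μ - hS.eigenvalues j) 0 ^ 2 ≤ ‖C - S‖ ^ 2 := by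
  obtain ⟨U, hU1, hU2, hSU⟩ := exists_orthogonal_diagonalization hS
  rw [← frobenius_sq_orthogonal_conj hU2]
  refine le_trans (Finset.sum_le_sum fun j _ => ?_) (sum_sq_diag_le _)
  have hcol : (fun i => U i j) ⬝ᵥ (fun i => U i j) = 1 := by
    have := congrFun (congrFun hU1 j) j
    simpa [Matrix.mul_apply, dotProduct] using this
  have hCj : (U.transpose * C * U) j j = (fun i => U i j) ⬝ᵥ C.mulVec (fun i => U i j) := by
    rw [Matrix.mul_assoc]
    simp [Matrix.mul_apply, dotProduct, Matrix.mulVec]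
  have hSj : U.transpose * S * U = Matrix.diagonal hS.eigenvalues := by
    conv_lhs => rw [hSU]
    calc _ = (U.transpose * U) * Matrix.diagonal hS.eigenvalues * (U.transpose * U) := by
          simp only [Matrix.mul_assoc]
      _ = _ := by simp [hU1]
  have hle : μ - hS.eigenvalues j ≤ (U.transpose * (C - S) * U) j j := by
    have := hC fun i => U i j
    rw [Matrix.mul_sub, Matrix.sub_mul, Matrix.sub_apply, hSj, Matrix.diagonal_apply_eq, hCj]
    rw [hcol] at this
    linarith
  rcases le_total (μ - hS.eigenvalues j) 0 with h | h
  · rw [max_eq_right h]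
    nlinarith [sq_nonneg ((U.transpose * (C - S) * U) j j)]
  · rw [max_eq_left h]
    exact pow_le_pow_left₀ h hle 2

/-- The characteristic polynomials differ by a power of the variable, so the larger spectrum is the
smaller one padded with zeros. -/
lemma sum_eigenvalues_mul_transpose_comm {ι : Type*} [Fintype ι] [DecidableEq ι] (φ : ℝ → ℝ)
    (Z : Matrix ι κ ℝ) (hle : Fintype.card κ ≤ Fintype.card ι)
    (h1 : (Z * Z.transpose).IsHermitian) (h2 : (Z.transpose * Z).IsHermitian) :
    ∑ j, φ (h1.eigenvalues j) =
      ((Fintype.card ι : ℝ) - Fintype.card κ) * φ 0 + ∑ i, φ (h2.eigenvalues i) := by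
  have hroots := congrArg Polynomial.roots (Matrix.charpoly_mul_comm_of_le Z Z.transpose hle)
  rw [Polynomial.roots_mul (mul_ne_zero (by simp) (Matrix.charpoly_monic _).ne_zero),
    h1.roots_charpoly_eq_eigenvalues, h2.roots_charpoly_eq_eigenvalues,
    Polynomial.roots_X_pow] at hroots
  have hsum := congrArg (fun s => (s.map φ).sum) hroots
  simpa [Nat.cast_sub hle, Multiset.map_nsmul, Multiset.sum_nsmul] using hsum

lemma convexOn_posPart_sq (μ : ℝ) : ConvexOn ℝ Set.univ fun b : ℝ => max (μ - b) 0 ^ 2 := by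
  have h1 : ConvexOn ℝ Set.univ fun b : ℝ => max (μ - b) 0 :=
    ((convexOn_const μ convex_univ).sub (concaveOn_id convex_univ)).sup
      (convexOn_const 0 convex_univ)
  exact h1.pow (fun _ _ => le_max_right _ _) 2

/-- A lower bound for `‖C - Z Zᵀ‖²` with `C ⪰ μ I` through the column norms of `Z`. -/
lemma posPart_column_norms_le {ι : Type*} [Fintype ι] [DecidableEq ι] {C : Matrix ι ι ℝ}
    (Z : Matrix ι κ ℝ) (hle : Fintype.card κ ≤ Fintype.card ι) {μ : ℝ} (hμ : 0 ≤ μ)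
    (hC : ∀ x : ι → ℝ, μ * (x ⬝ᵥ x) ≤ x ⬝ᵥ C.mulVec x) :
    ((Fintype.card ι : ℝ) - Fintype.card κ) * μ ^ 2 +
      ∑ i, max (μ - (Z.transpose * Z) i i) 0 ^ 2 ≤ ‖C - Z * Z.transpose‖ ^ 2 := by
  have h1 : (Z * Z.transpose).IsHermitian := by
    simpa using Matrix.isHermitian_mul_conjTranspose_self Z
  have h2 : (Z.transpose * Z).IsHermitian := by
    simpa using Matrix.isHermitian_conjTranspose_mul_self Z
  refine le_trans ?_ (sum_posPart_eigenvalues_le h1 hC)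
  -- Each padding zero contributes μ²; convexity then replaces eigenvalues by column norms.
  rw [sum_eigenvalues_mul_transpose_comm (fun b => max (μ - b) 0 ^ 2) Z hle h1 h2, sub_zero,
    max_eq_left hμ]
  refine add_le_add_right ?_ _
  exact sum_convex_diag_le (convexOn_posPart_sq μ) h2

end Spectral

/-! ### Scalar inequalities for the normal part -/

section Scalar

lemma sq_add_le_of_split {a b k p q : ℝ} (ha : 0 ≤ a) (hk : 0 ≤ k) (hq : 0 ≤ q)
    (hak : a ^ 2 ≤ b * k) (hqp : q ≤ p) (hab : a ≤ b) (h : a + p ≤ b + q) :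
    (a + p) ^ 2 ≤ (b + q) * (k + 2 * p - q) := by
  rcases (ha.trans hab).eq_or_lt with hb | hb
  · have ha0 : a = 0 := le_antisymm (hb ▸ hab) ha
    have hpq : p = q := by linarith
    subst hb ha0 hpq
    nlinarith
  · refine le_of_mul_le_mul_left ?_ hb
    have h1 : (b + q) * a ^ 2 ≤ (b + q) * (b * k) := mul_le_mul_of_nonneg_left hak (by linarith)
    have h2 : 0 ≤ b * (2 * p - q) - a * q := by nlinarith
    have h3 : 0 ≤ b * p - a * q := by nlinarith
    -- (b+q)(a² + b(2p−q)) − b(a+p)² = (b+q−a−p)(b(2p−q)−aq) + (p−q)(bp−aq).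
    nlinarith [mul_nonneg (sub_nonneg.2 h) h2, mul_nonneg (sub_nonneg.2 hqp) h3]

/-- Indices with w ≥ μ are handled by Cauchy–Schwarz; on the others w² ≤ μw. `sq_add_le_of_split`
combines the two groups. -/
lemma sq_mul_sum_le {κ : Type*} [Fintype κ] {w : κ → ℝ} (hw : ∀ i, 0 ≤ w i) {μ : ℝ} (hμ : 0 ≤ μ)
    (h : μ * ∑ i, w i ≤ ∑ i, w i ^ 2) :
    (μ * ∑ i, w i) ^ 2 ≤
      (∑ i, w i ^ 2) * ∑ i, (if μ ≤ w i then μ ^ 2 else 2 * μ * w i - w i ^ 2) := by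
  classical
  set L := Finset.univ.filter fun i => μ ≤ w i
  set S := Finset.univ.filter fun i => ¬ μ ≤ w i
  have hsplit (f : κ → ℝ) : ∑ i, f i = ∑ i ∈ L, f i + ∑ i ∈ S, f i :=
    (Finset.sum_filter_add_sum_filter_not _ _ _).symm
  have hg : ∑ i, (if μ ≤ w i then μ ^ 2 else 2 * μ * w i - w i ^ 2) =
      L.card * μ ^ 2 + 2 * (μ * ∑ i ∈ S, w i) - ∑ i ∈ S, w i ^ 2 := by
    rw [Finset.sum_ite, Finset.sum_const, nsmul_eq_mul, Finset.sum_sub_distrib, ← Finset.mul_sum]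
    ring
  have hcs : (∑ i ∈ L, w i) ^ 2 ≤ L.card * ∑ i ∈ L, w i ^ 2 := sq_sum_le_card_mul_sum_sq
  rw [hg, hsplit w, hsplit fun i => w i ^ 2, mul_add]
  rw [hsplit w, hsplit fun i => w i ^ 2, mul_add] at h
  refine sq_add_le_of_split (mul_nonneg hμ (Finset.sum_nonneg fun i _ => hw i)) (by positivity)
    (Finset.sum_nonneg fun i _ => sq_nonneg _) ?_ ?_ ?_ h
  · nlinarith [mul_le_mul_of_nonneg_left hcs (sq_nonneg μ)]
  · rw [Finset.mul_sum]
    refine Finset.sum_le_sum fun i hi => ?_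
    have := (Finset.mem_filter.1 hi).2
    nlinarith [hw i]
  · rw [Finset.mul_sum]
    refine Finset.sum_le_sum fun i hi => ?_
    have := (Finset.mem_filter.1 hi).2
    nlinarith [hw i]

/-- The left side is the minimum of the right over b ≥ 0, attained at b = 0 if w ≥ μ and at b = μ −
w otherwise. -/
lemma posPart_sq_add_ge {μ b w : ℝ} (hμ : 0 ≤ μ) (hb : 0 ≤ b) (hw : 0 ≤ w) :
    (if μ ≤ w then μ ^ 2 else 2 * μ * w - w ^ 2) ≤ max (μ - b) 0 ^ 2 + 2 * (b * w) := by
  split_ifs with h <;> rcases le_total (μ - b) 0 with h1 | h1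
  · rw [max_eq_right h1]
    nlinarith
  · rw [max_eq_left h1]
    nlinarith
  · rw [max_eq_right h1]
    nlinarith
  · rw [max_eq_left h1]
    nlinarith [sq_nonneg (μ - b - w)]

end Scalar

/-! ### Tangent and normal parts -/

section Geometry

lemma frobenius_sq_congruence_eq_trace {ν ρ : Type*} [Fintype ν] [Fintype ρ] (X : Matrix ν ρ ℝ)
    (M : Matrix ρ ρ ℝ) : ‖X * M * X.transpose‖ ^ 2 =
      (M.transpose * (X.transpose * X) * M * (X.transpose * X)).trace := by
  rw [frobenius_sq_eq_trace]
  simp only [Matrix.transpose_mul, Matrix.transpose_transpose, Matrix.mul_assoc]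
  rw [Matrix.trace_mul_comm]
  simp only [Matrix.mul_assoc]

/-- The norm depends on X only through its Gram matrix, so X may be replaced by a convenient square
factor. -/
lemma frobenius_sq_congruence {ν ρ κ : Type*} [Fintype ν] [Fintype ρ] [Fintype κ]
    (X : Matrix ν ρ ℝ) (L : Matrix κ ρ ℝ) (hL : L.transpose * L = X.transpose * X)
    (M : Matrix ρ ρ ℝ) : ‖X * M * X.transpose‖ ^ 2 = ‖L * M * L.transpose‖ ^ 2 := by
  rw [frobenius_sq_congruence_eq_trace, frobenius_sq_congruence_eq_trace, hL]

lemma transpose_mul_eq_zero_comm {ν ρ κ : Type*} [Fintype ν] {X : Matrix ν ρ ℝ}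
    {Y : Matrix ν κ ℝ} (h : X.transpose * Y = 0) : Y.transpose * X = 0 := by
  have := congrArg Matrix.transpose h
  simpa using this

variable {ν ρ κ : Type*} [Fintype ν] [Fintype ρ] [Fintype κ]

lemma frobenius_sq_mul_transpose_diagonal [DecidableEq κ] {Y : Matrix ν κ ℝ} {w : κ → ℝ}
    (hY : Y.transpose * Y = Matrix.diagonal w) : ‖Y * Y.transpose‖ ^ 2 = ∑ i, w i ^ 2 := by
  rw [frobenius_sq_eq_trace]
  calc ((Y * Y.transpose).transpose * (Y * Y.transpose)).trace
      = (Y * ((Y.transpose * Y) * Y.transpose)).trace := by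
        simp only [Matrix.transpose_mul, Matrix.transpose_transpose, Matrix.mul_assoc]
    _ = ∑ i, w i ^ 2 := by
        rw [Matrix.trace_mul_comm, Matrix.mul_assoc, hY, Matrix.diagonal_mul_diagonal,
          Matrix.trace_diagonal]
        simp [sq]

/-- The part of `X Xᵀ - Z Zᵀ` tangent to the variety of factorizations, split into its block on
the column space of `X` and its off-diagonal blocks. -/
lemma frobenius_sq_tangent_part [DecidableEq ρ] [DecidableEq κ] {X : Matrix ν ρ ℝ}
    {Y : Matrix ν κ ℝ} (R : Matrix ρ κ ℝ) (hXY : X.transpose * Y = 0) {w : κ → ℝ}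
    (hY : Y.transpose * Y = Matrix.diagonal w) :
    ‖X * X.transpose - (X * R + Y) * (X * R + Y).transpose + Y * Y.transpose‖ ^ 2 =
      ‖X * (1 - R * R.transpose) * X.transpose‖ ^ 2 +
        2 * ∑ i, (R.transpose * (X.transpose * X) * R) i i * w i := by
  have hYX := transpose_mul_eq_zero_comm hXY
  set P := X * (1 - R * R.transpose) * X.transpose with hP
  set K := X * R * Y.transpose with hK
  have hsplit : X * X.transpose - (X * R + Y) * (X * R + Y).transpose + Y * Y.transpose =
      P - K - K.transpose := by
    simp only [hP, hK, Matrix.transpose_add, Matrix.transpose_mul, Matrix.add_mul, Matrix.mul_add,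
      Matrix.mul_sub, Matrix.sub_mul, Matrix.mul_one, Matrix.transpose_transpose, Matrix.mul_assoc]
    abel
  have hPt : P.transpose = P := by
    simp [hP, Matrix.transpose_mul, Matrix.mul_assoc]
  have h1 : P * K.transpose = 0 := by
    calc P * K.transpose
        = X * (1 - R * R.transpose) * (X.transpose * Y) * (R.transpose * X.transpose) := by
          simp only [hP, hK, Matrix.transpose_mul, Matrix.transpose_transpose, Matrix.mul_assoc]
      _ = 0 := by simp [hXY]
  have h2 : K * P = 0 := by
    calc K * P = X * R * (Y.transpose * X) * ((1 - R * R.transpose) * X.transpose) := by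
          simp only [hP, hK, Matrix.mul_assoc]
      _ = 0 := by simp [hYX]
  have h3 : K * K = 0 := by
    calc K * K = X * R * (Y.transpose * X) * (R * Y.transpose) := by
          simp only [hK, Matrix.mul_assoc]
      _ = 0 := by simp [hYX]
  have h4 : K.transpose * K.transpose = 0 := by
    rw [← Matrix.transpose_mul, h3, Matrix.transpose_zero]
  have hKK : (K.transpose * K).trace = ∑ i, (R.transpose * (X.transpose * X) * R) i i * w i := by
    calc (K.transpose * K).trace
        = (Y * (R.transpose * (X.transpose * X) * R * Y.transpose)).trace := by
          simp only [hK, Matrix.transpose_mul, Matrix.transpose_transpose, Matrix.mul_assoc]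
      _ = (R.transpose * (X.transpose * X) * R * Matrix.diagonal w).trace := by
          rw [Matrix.trace_mul_comm, Matrix.mul_assoc _ Y.transpose, hY]
      _ = _ := by simp [Matrix.trace, Matrix.mul_diagonal]
  rw [hsplit, frobenius_sq_eq_trace, frobenius_sq_eq_trace, ← hKK]
  simp only [Matrix.transpose_sub, Matrix.transpose_transpose, hPt, Matrix.sub_mul, Matrix.mul_sub,
    Matrix.trace_sub, h1, h2, h3, h4, Matrix.trace_mul_comm P K, Matrix.trace_mul_comm K.transpose P,
    Matrix.trace_mul_comm K K.transpose, Matrix.trace_zero]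
  ring

/-- The normal part `Y Yᵀ` of `Z Zᵀ` is controlled by the tangent part of `X Xᵀ - Z Zᵀ`. -/
theorem normal_part_bound [DecidableEq ρ] [DecidableEq κ] {X : Matrix ν ρ ℝ} {Y : Matrix ν κ ℝ}
    (R : Matrix ρ κ ℝ) (hXY : X.transpose * Y = 0) {w : κ → ℝ}
    (hY : Y.transpose * Y = Matrix.diagonal w) (hw : ∀ i, 0 ≤ w i)
    (hcard : Fintype.card κ ≤ Fintype.card ρ) {μ : ℝ} (hμ : 0 ≤ μ)
    (hX : ∀ x : ρ → ℝ, μ * (x ⬝ᵥ x) ≤ X.mulVec x ⬝ᵥ X.mulVec x)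
    (hμw : μ * ∑ i, w i ≤ ∑ i, w i ^ 2) :
    Fintype.card ρ * (μ * ∑ i, w i) ^ 2 ≤ Fintype.card κ * (‖Y * Y.transpose‖ ^ 2 *
      ‖X * X.transpose - (X * R + Y) * (X * R + Y).transpose + Y * Y.transpose‖ ^ 2) := by
  have hC : (X.transpose * X).IsHermitian := by
    simpa using Matrix.isHermitian_conjTranspose_mul_self X
  obtain ⟨O, hO1, hO2, hCO⟩ := exists_orthogonal_diagonalization hC
  set s := hC.eigenvalues
  have hs (j : ρ) : μ ≤ s j := by
    have hcol : (fun i => O i j) ⬝ᵥ (fun i => O i j) = 1 := by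
      have := congrFun (congrFun hO1 j) j
      simpa [Matrix.mul_apply, dotProduct] using this
    have hXO : (X * O).transpose * (X * O) = Matrix.diagonal s := by
      calc (X * O).transpose * (X * O) = O.transpose * (X.transpose * X) * O := by
            simp only [Matrix.transpose_mul, Matrix.mul_assoc]
        _ = (O.transpose * O) * Matrix.diagonal s * (O.transpose * O) := by
            rw [hCO]
            simp only [Matrix.mul_assoc]
        _ = Matrix.diagonal s := by simp [hO1]
    have hj : X.mulVec (fun i => O i j) ⬝ᵥ X.mulVec (fun i => O i j) = s j := by
      have := congrFun (congrFun hXO j) j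
      rwa [Matrix.diagonal_apply_eq] at this
    have := hX fun i => O i j
    rwa [hcol, mul_one, hj] at this
  have hsqrt : Matrix.diagonal (fun j => √(s j)) * Matrix.diagonal (fun j => √(s j)) =
      Matrix.diagonal s := by
    rw [Matrix.diagonal_mul_diagonal]
    congr 1
    funext j
    exact Real.mul_self_sqrt (hμ.trans (hs j))
  -- This square factor has the Gram matrix of X, while LLᵀ is diagonal with entries at least μ.
  set L := Matrix.diagonal (fun j => √(s j)) * O.transpose with hL
  have hLL : L.transpose * L = X.transpose * X := by
    rw [hCO, hL, ← hsqrt]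
    simp only [Matrix.transpose_mul, Matrix.transpose_transpose, Matrix.diagonal_transpose,
      Matrix.mul_assoc]
  have hLL' : L * L.transpose = Matrix.diagonal s := by
    calc L * L.transpose = Matrix.diagonal (fun j => √(s j)) * (O.transpose * O) *
          Matrix.diagonal (fun j => √(s j)) := by
          simp only [hL, Matrix.transpose_mul, Matrix.transpose_transpose,
            Matrix.diagonal_transpose, Matrix.mul_assoc]
      _ = Matrix.diagonal s := by rw [hO1, Matrix.mul_one, hsqrt]
  have hblock : ‖X * (1 - R * R.transpose) * X.transpose‖ ^ 2 =
      ‖Matrix.diagonal s - (L * R) * (L * R).transpose‖ ^ 2 := by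
    rw [frobenius_sq_congruence X L hLL]
    congr 2
    rw [← hLL']
    simp [Matrix.mul_sub, Matrix.sub_mul, Matrix.mul_assoc]
  have hdiag : R.transpose * (X.transpose * X) * R = (L * R).transpose * (L * R) := by
    rw [← hLL]
    simp only [Matrix.transpose_mul, Matrix.mul_assoc]
  have hlow := posPart_column_norms_le (C := Matrix.diagonal s) (L * R) hcard hμ fun x => by
    simp only [Matrix.mulVec_diagonal, dotProduct, Finset.mul_sum]
    refine Finset.sum_le_sum fun j _ => ?_
    nlinarith [hs j, mul_self_nonneg (x j)]
  have hb (i : κ) : 0 ≤ ((L * R).transpose * (L * R)) i i := by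
    simp only [Matrix.mul_apply (M := (L * R).transpose), Matrix.transpose_apply]
    exact Finset.sum_nonneg fun j _ => mul_self_nonneg _
  have hN : ((Fintype.card ρ : ℝ) - Fintype.card κ) * μ ^ 2 +
      ∑ i, (if μ ≤ w i then μ ^ 2 else 2 * μ * w i - w i ^ 2) ≤
      ‖X * X.transpose - (X * R + Y) * (X * R + Y).transpose + Y * Y.transpose‖ ^ 2 := by
    rw [frobenius_sq_tangent_part R hXY hY, hblock, hdiag, Finset.mul_sum]
    have := Finset.sum_le_sum fun i (_ : i ∈ Finset.univ) =>
      posPart_sq_add_ge hμ (hb i) (hw i)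
    rw [Finset.sum_add_distrib] at this
    linarith
  have hcs : (∑ i, w i) ^ 2 ≤ Fintype.card κ * ∑ i, w i ^ 2 := by
    simpa using sq_sum_le_card_mul_sum_sq (s := Finset.univ) (f := w)
  have hg := sq_mul_sum_le hw hμ hμw
  have hcard' : (0 : ℝ) ≤ (Fintype.card ρ : ℝ) - Fintype.card κ := by
    rw [sub_nonneg]
    exact_mod_cast hcard
  rw [frobenius_sq_mul_transpose_diagonal hY]
  have hw2 : 0 ≤ ∑ i, w i ^ 2 := Finset.sum_nonneg fun i _ => sq_nonneg _
  set T := ∑ i, w i ^ 2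
  set σ := ∑ i, w i
  set Γ := ∑ i, (if μ ≤ w i then μ ^ 2 else 2 * μ * w i - w i ^ 2)
  -- Split r = (r − k) + k: Cauchy–Schwarz treats the first share, `sq_mul_sum_le` the second.
  calc Fintype.card ρ * (μ * σ) ^ 2
      = ((Fintype.card ρ : ℝ) - Fintype.card κ) * μ ^ 2 * σ ^ 2
        + Fintype.card κ * (μ * σ) ^ 2 := by ring
    _ ≤ ((Fintype.card ρ : ℝ) - Fintype.card κ) * μ ^ 2 * (Fintype.card κ * T)
        + Fintype.card κ * (T * Γ) := by gcongr
    _ = Fintype.card κ * (T * (((Fintype.card ρ : ℝ) - Fintype.card κ) * μ ^ 2 + Γ)) := by ring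
    _ ≤ _ := by gcongr

end Geometry

/-! ### Factorizations, singular vectors and curvature -/

lemma exists_factorization {n k : ℕ} {M : Matrix (Fin n) (Fin n) ℝ} (hM : M.PosSemidef)
    (hk : M.rank = k) : ∃ Z : Matrix (Fin n) (Fin k) ℝ, M = Z * Z.transpose := by
  obtain ⟨U, -, -, hMU⟩ := exists_orthogonal_diagonalization hM.isHermitian
  set d := hM.isHermitian.eigenvalues
  have hd := hM.eigenvalues_nonneg
  have hcard : Fintype.card {i // d i ≠ 0} = k := by
    rw [← hk, hM.isHermitian.rank_eq_card_non_zero_eigs]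
  let e : {i // d i ≠ 0} ≃ Fin k := Fintype.equivFinOfCardEq hcard
  refine ⟨Matrix.of fun i j => U i (e.symm j) * √(d (e.symm j)), ?_⟩
  ext a b
  conv_lhs => rw [hMU]
  rw [Matrix.mul_apply, Matrix.mul_apply]
  simp only [Matrix.mul_diagonal, Matrix.transpose_apply, Matrix.of_apply]
  rw [e.symm.sum_comp fun j : {i // d i ≠ 0} => U a j * √(d j) * (U b j * √(d j)),
    ← Finset.sum_subtype (Finset.univ.filter fun i => d i ≠ 0) (by simp)
      fun j => U a j * √(d j) * (U b j * √(d j)), Finset.sum_filter]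
  refine Finset.sum_congr rfl fun j _ => ?_
  split_ifs with hj
  · linear_combination U a j * U b j * (Real.mul_self_sqrt (hd j)).symm
  · simp [not_not.1 hj]

/-- Least squares splits Z₀ along the column space of X. Rotating its columns by eigenvectors of the
residual's Gram matrix keeps Z₀Z₀ᵀ and makes the residual columns orthogonal. -/
lemma exists_normal_decomposition {n r k : ℕ} (X : Matrix (Fin n) (Fin r) ℝ)
    (hX : IsUnit (X.transpose * X).det) (Z₀ : Matrix (Fin n) (Fin k) ℝ) :
    ∃ (R : Matrix (Fin r) (Fin k) ℝ) (Y : Matrix (Fin n) (Fin k) ℝ) (w : Fin k → ℝ),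
      Z₀ * Z₀.transpose = (X * R + Y) * (X * R + Y).transpose ∧ X.transpose * Y = 0 ∧
        Y.transpose * Y = Matrix.diagonal w ∧ ∀ i, 0 ≤ w i := by
  set R₀ := (X.transpose * X)⁻¹ * (X.transpose * Z₀) with hR₀
  set Y₀ := Z₀ - X * R₀ with hY₀
  have hXY : X.transpose * Y₀ = 0 := by
    rw [hY₀, Matrix.mul_sub, hR₀, ← Matrix.mul_assoc X.transpose X,
      Matrix.mul_nonsing_inv_cancel_left _ _ hX, sub_self]
  have hS : (Y₀.transpose * Y₀).PosSemidef := by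
    simpa using Matrix.posSemidef_conjTranspose_mul_self Y₀
  obtain ⟨U, hU1, hU2, hSU⟩ := exists_orthogonal_diagonalization hS.isHermitian
  refine ⟨R₀ * U, Y₀ * U, hS.isHermitian.eigenvalues, ?_, ?_, ?_, hS.eigenvalues_nonneg⟩
  · have hZ : X * (R₀ * U) + Y₀ * U = Z₀ * U := by
      rw [hY₀, Matrix.sub_mul, ← Matrix.mul_assoc, add_sub_cancel]
    rw [hZ, Matrix.transpose_mul, Matrix.mul_assoc, ← Matrix.mul_assoc U, hU2, Matrix.one_mul]
  · rw [← Matrix.mul_assoc, hXY, Matrix.zero_mul]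
  · calc (Y₀ * U).transpose * (Y₀ * U) = U.transpose * (Y₀.transpose * Y₀) * U := by
          simp only [Matrix.transpose_mul, Matrix.mul_assoc]
      _ = (U.transpose * U) * Matrix.diagonal hS.isHermitian.eigenvalues * (U.transpose * U) := by
          conv_lhs => rw [hSU]
          simp only [Matrix.mul_assoc]
      _ = _ := by simp [hU1]

/-- The smallest singular value of an `n × r` matrix is the minimum of `‖X v‖` over unit
vectors `v`. -/
lemma exists_minimal_singular_vector {n r : ℕ} (hr : 0 < r) (X : Matrix (Fin n) (Fin r) ℝ) :
    (∃ v : Fin r → ℝ, v ⬝ᵥ v = 1 ∧ X.mulVec v ⬝ᵥ X.mulVec v = sigma X r ^ 2) ∧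
      ∀ x : Fin r → ℝ, sigma X r ^ 2 * (x ⬝ᵥ x) ≤ X.mulVec x ⬝ᵥ X.mulVec x := by
  set T := Matrix.toEuclideanLin X with hT
  have hn : Module.finrank ℝ (EuclideanSpace ℝ (Fin r)) = r := finrank_euclideanSpace_fin
  have hsym := T.isSymmetric_adjoint_comp_self
  set b := hsym.eigenvectorBasis hn
  -- Zero-based, r − 1 is the last eigenvalue of XᵀX, hence the least, also when r > n.
  have hlast : r - 1 < r := by omega
  have hσ : sigma X r ^ 2 = hsym.eigenvalues hn ⟨r - 1, hlast⟩ :=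
    T.sq_singularValues_of_lt hn hlast
  have hdot {k : ℕ} (x : EuclideanSpace ℝ (Fin k)) : ‖x‖ ^ 2 = x.ofLp ⬝ᵥ x.ofLp := by
    rw [EuclideanSpace.norm_sq_eq]
    simp [dotProduct, sq]
  have hTx (x : EuclideanSpace ℝ (Fin r)) :
      ‖T x‖ ^ 2 = ∑ i, hsym.eigenvalues hn i * inner ℝ (b i) x ^ 2 := by
    rw [← real_inner_self_eq_norm_sq, ← LinearMap.adjoint_inner_right,
      ← b.sum_inner_mul_inner x]
    refine Finset.sum_congr rfl fun i _ => ?_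
    have h1 : inner ℝ (b i) (LinearMap.adjoint T (T x)) =
        hsym.eigenvalues hn i * inner ℝ (b i) x := by
      rw [← LinearMap.comp_apply, ← hsym, hsym.apply_eigenvectorBasis, inner_smul_left]
      rfl
    rw [h1, real_inner_comm]
    ring
  have hX (x : EuclideanSpace ℝ (Fin r)) : ‖T x‖ ^ 2 = X.mulVec x.ofLp ⬝ᵥ X.mulVec x.ofLp := by
    rw [hdot]
    rfl
  constructor
  · refine ⟨(b ⟨r - 1, hlast⟩).ofLp, ?_, ?_⟩
    · rw [← hdot, b.orthonormal.1]
      norm_num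
    · rw [← hX, hTx, hσ, Finset.sum_eq_single ⟨r - 1, hlast⟩]
      · simp
      · intro i _ hi
        simp [b.orthonormal.2 hi]
      · simp
  · intro x
    have hx := hdot (WithLp.toLp 2 x : EuclideanSpace ℝ (Fin r))
    have h2 := hX (WithLp.toLp 2 x)
    simp only at hx h2
    rw [← hx, ← h2, hTx, hσ, ← b.sum_sq_inner_right, Finset.mul_sum]
    refine Finset.sum_le_sum fun i _ => mul_le_mul_of_nonneg_right ?_ (sq_nonneg _)
    exact hsym.eigenvalues_antitone hn (by rw [Fin.le_def]; simp only; omega)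

lemma isUnit_det_gram {n r : ℕ} {X : Matrix (Fin n) (Fin r) ℝ} {l : ℝ} (hl : 0 < l)
    (hX : ∀ x : Fin r → ℝ, l * (x ⬝ᵥ x) ≤ X.mulVec x ⬝ᵥ X.mulVec x) :
    IsUnit (X.transpose * X).det := by
  rw [isUnit_iff_ne_zero, ne_eq, ← Matrix.exists_mulVec_eq_zero_iff]
  rintro ⟨x, hx0, hx⟩
  have h0 : X.mulVec x ⬝ᵥ X.mulVec x = 0 := by
    rw [Matrix.dotProduct_mulVec, ← Matrix.mulVec_transpose, Matrix.mulVec_mulVec, hx,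
      zero_dotProduct]
  have hpos : 0 < x ⬝ᵥ x := by
    simpa using Matrix.dotProduct_star_self_pos_iff.2 hx0
  have := hX x
  rw [h0] at this
  nlinarith [mul_pos hl hpos]

lemma frobenius_sq_vecMulVec_add_swap {ν : Type*} [Fintype ν] (p u : ν → ℝ) :
    ‖Matrix.vecMulVec p u + Matrix.vecMulVec u p‖ ^ 2 =
      2 * ((p ⬝ᵥ p) * (u ⬝ᵥ u) + (p ⬝ᵥ u) ^ 2) := by
  have h1 : (p ⬝ᵥ p) * (u ⬝ᵥ u) = ∑ i, ∑ j, p i * p i * (u j * u j) :=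
    Finset.sum_mul_sum _ _ _ _
  have h2 : (p ⬝ᵥ u) ^ 2 = ∑ i, ∑ j, p i * u i * (p j * u j) := by
    rw [sq]
    exact Finset.sum_mul_sum _ _ _ _
  have h3 : (p ⬝ᵥ p) * (u ⬝ᵥ u) = ∑ i, ∑ j, p j * p j * (u i * u i) := by
    rw [h1, Finset.sum_comm]
  have h4 : 2 * ((p ⬝ᵥ p) * (u ⬝ᵥ u) + (p ⬝ᵥ u) ^ 2) =
      (p ⬝ᵥ p) * (u ⬝ᵥ u) + (p ⬝ᵥ p) * (u ⬝ᵥ u) + 2 * (p ⬝ᵥ u) ^ 2 := by ring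
  rw [h4]
  nth_rewrite 1 [h1]
  rw [h3, h2, frobenius_sq, Finset.mul_sum]
  simp only [Finset.mul_sum, ← Finset.sum_add_distrib]
  refine Finset.sum_congr rfl fun i _ => Finset.sum_congr rfl fun j _ => ?_
  simp only [Matrix.add_apply, Matrix.vecMulVec_apply]
  ring

lemma rank_mul_add_mul_le {ν ν' ρ κ : Type*} [Fintype ν] [Fintype ν'] [Fintype ρ] [Fintype κ]
    (X : Matrix ν ρ ℝ) (Z : Matrix ν κ ℝ) (P : Matrix ρ ν' ℝ) (Q : Matrix κ ν' ℝ) :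
    (X * P + Z * Q).rank ≤ Fintype.card ρ + Fintype.card κ := by
  rw [← Matrix.fromCols_mul_fromRows, ← Fintype.card_sum]
  exact (Matrix.rank_mul_le_left _ _).trans (Matrix.rank_le_card_width _)

/-- Curvature of the objective in a direction `u vᵀ` with `v` a unit vector. -/
lemma IsSecondOrderCritical.curvature {n m r g : ℕ} {A : Fin m → Matrix (Fin n) (Fin n) ℝ}
    {δ : ℝ} (hRIP : RIP A δ g) (hg : 2 ≤ g)
    {Mstar : Matrix (Fin n) (Fin n) ℝ} {w : EuclideanSpace ℝ (Fin m)}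
    {X : Matrix (Fin n) (Fin r) ℝ} (h : IsSecondOrderCritical (objective A Mstar w) X)
    {v : Fin r → ℝ} (hv : v ⬝ᵥ v = 1) (u : Fin n → ℝ) :
    -((1 + δ) * ((X.mulVec v ⬝ᵥ X.mulVec v) * (u ⬝ᵥ u) + (X.mulVec v ⬝ᵥ u) ^ 2)) ≤
      inner ℝ (measurementLin A (X * X.transpose - Mstar) + w)
        (measurementLin A (Matrix.vecMulVec u u)) := by
  have hH := h.hessian_nonneg (Matrix.vecMulVec u v)
  have h1 : Matrix.vecMulVec u v * (Matrix.vecMulVec u v).transpose = Matrix.vecMulVec u u := by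
    rw [Matrix.transpose_vecMulVec, Matrix.vecMulVec_mul_vecMulVec, hv]
    simp
  have h2 : X * (Matrix.vecMulVec u v).transpose = Matrix.vecMulVec (X.mulVec v) u := by
    rw [Matrix.transpose_vecMulVec, Matrix.mul_vecMulVec]
  have h3 : Matrix.vecMulVec u v * X.transpose = Matrix.vecMulVec u (X.mulVec v) := by
    rw [Matrix.vecMulVec_mul, Matrix.vecMul_transpose]
  rw [h1, h2, h3] at hH
  have hrank : (Matrix.vecMulVec (X.mulVec v) u + Matrix.vecMulVec u (X.mulVec v)).rank ≤ g := by
    rw [Matrix.vecMulVec_eq Unit, Matrix.vecMulVec_eq Unit]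
    exact (rank_mul_add_mul_le _ _ _ _).trans (by simpa using hg)
  have hR := (hRIP.2.2 _ hrank).2
  rw [frobenius_sq_vecMulVec_add_swap, ← measurementLin_apply] at hR
  linarith

lemma mul_transpose_eq_sum_vecMulVec {ν κ : Type*} [Fintype κ] (Z : Matrix ν κ ℝ) :
    Z * Z.transpose = ∑ i, Matrix.vecMulVec (fun a => Z a i) (fun a => Z a i) := by
  ext a b
  simp [Matrix.mul_apply, Matrix.sum_apply, Matrix.vecMulVec_apply]

/-- ZZᵀ and ZᵀZ have equal Frobenius norm, and the latter has only k diagonal entries. -/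
lemma trace_transpose_mul_self_le {n k : ℕ} (Z : Matrix (Fin n) (Fin k) ℝ) :
    (Z.transpose * Z).trace ≤ √(k : ℝ) * ‖Z * Z.transpose‖ := by
  have h1 : ‖Z * Z.transpose‖ ^ 2 = ‖Z.transpose * Z‖ ^ 2 := by
    have h := frobenius_sq_congruence_eq_trace Z 1
    have h' := frobenius_sq_eq_trace (Z.transpose * Z)
    simp only [Matrix.mul_one, Matrix.one_mul, Matrix.transpose_one, Matrix.transpose_mul,
      Matrix.transpose_transpose] at h h'
    rw [h, h']
  refine Real.le_sqrt_of_sq_le ?_ |>.trans_eq (by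
    rw [← Real.sqrt_sq (norm_nonneg (Z * Z.transpose)), ← Real.sqrt_mul (Nat.cast_nonneg k)])
  rw [h1]
  refine le_trans ?_ (mul_le_mul_of_nonneg_left (sum_sq_diag_le _) (Nat.cast_nonneg k))
  simpa [Matrix.trace] using sq_sum_le_card_mul_sum_sq (s := Finset.univ) (f := fun i => (Z.transpose * Z) i i)

/-! ### Scalar inequalities closing the two cases -/

lemma le_quadratic_root_bound {a ε s m e : ℝ} (ha : 0 < a) (hε : 0 ≤ ε) (hs : 1 ≤ s) (hm : 0 ≤ m)
    (he : 0 ≤ e) (h : a * e ^ 2 ≤ ε * e + 2 * ε * (s * m)) :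
    e ≤ (ε * s + √(ε ^ 2 * s ^ 2 + 16 * a * ε * s * m)) / (2 * a) := by
  rw [le_div_iff₀ (by positivity)]
  have h1 : (2 * a * e - ε * s) ^ 2 ≤ ε ^ 2 * s ^ 2 + 16 * a * ε * s * m := by
    have h2 : a * e ^ 2 ≤ ε * e * s + 2 * ε * (s * m) := by
      nlinarith [mul_nonneg hε he]
    nlinarith [mul_le_mul_of_nonneg_left h2 ha.le, mul_nonneg (mul_nonneg ha.le hε)
      (mul_nonneg (zero_le_one.trans hs) hm)]
  linarith [(le_abs_self _).trans (Real.abs_le_sqrt h1)]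

/-- Optimization over the test matrices `F = N - y W`. -/
lemma residual_le_of_test_family {n w e q t δ ε : ℝ} (hn : 0 ≤ n) (hw : 0 ≤ w) (he : 0 ≤ e)
    (ht : 0 < t) (hδ0 : 0 ≤ δ) (hδ : δ < 1 / (1 + t)) (hε : 0 ≤ ε)
    (hpyth : e ^ 2 = n ^ 2 + w ^ 2)
    (hsmall : q ≤ w ^ 2 → q ≤ t * (w * n)) (hlarge : w ^ 2 < q → w ≤ t * n)
    (htest : ∀ y f : ℝ, 0 ≤ y → 0 ≤ f → f ^ 2 = n ^ 2 + y ^ 2 * w ^ 2 →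
      n ^ 2 + y * w ^ 2 ≤ y * ((1 + δ) * q) + (δ * e + ε) * f) :
    (1 / (1 + t) - δ) * e ≤ ε := by
  set d := 1 / (1 + t) with hd
  have hd0 : 0 < d := by positivity
  have hdt : d * (1 + t) = 1 := by rw [hd]; field_simp
  have hd1 : d < 1 := by nlinarith
  set k := t * (1 + d) with hk
  have hdk : d * k = 1 - d ^ 2 := by rw [hk]; linear_combination (1 + d) * hdt
  have hk0 : 0 ≤ k := by positivity
  have htk : t ≤ k := by nlinarith
  -- it is enough to find a test matrix of norm `f ≥ d e` with `f ≤ δ e + ε`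
  suffices h : ∃ f, d * e ≤ f ∧ f ≤ δ * e + ε by
    obtain ⟨f, h1, h2⟩ := h
    linarith
  have hcancel {f : ℝ} (hf : 0 ≤ f) (h : f ^ 2 ≤ (δ * e + ε) * f) : f ≤ δ * e + ε := by
    rcases hf.eq_or_lt with h0 | h0
    · rw [← h0]; positivity
    · exact le_of_mul_le_mul_right (by linarith) h0
  rcases le_or_gt w (k * n) with hwk | hwk
  · refine ⟨n, abs_le_of_sq_le_sq' ?_ hn |>.2, hcancel hn ?_⟩
    · have h1 : w ^ 2 ≤ (k * n) ^ 2 := pow_le_pow_left₀ hw hwk 2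
      have h2 : d ^ 2 * (k * n) ^ 2 = (1 - d ^ 2) ^ 2 * n ^ 2 := by rw [← hdk]; ring
      have h3 : d ^ 2 * w ^ 2 ≤ (1 - d ^ 2) ^ 2 * n ^ 2 := by
        rw [← h2]; exact mul_le_mul_of_nonneg_left h1 (sq_nonneg d)
      have h4 : (d ^ 2 + (1 - d ^ 2) ^ 2) * n ^ 2 ≤ 1 * n ^ 2 := by
        refine mul_le_mul_of_nonneg_right ?_ (sq_nonneg n)
        nlinarith [sq_nonneg d, mul_nonneg (sq_nonneg d) (show 0 ≤ 1 - d ^ 2 by nlinarith)]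
      rw [mul_pow, hpyth]
      linarith
    · have := htest 0 n le_rfl hn (by ring)
      linarith
  · have hw0 : 0 < w := lt_of_le_of_lt (mul_nonneg hk0 hn) hwk
    have hq : q ≤ t * (w * n) := by
      refine hsmall (le_of_not_gt fun hlt => ?_)
      have := hlarge hlt
      nlinarith
    -- With y = z/w the cost is at most zkn, and n² + zw − zkn = n² + z² = f².
    set z := w - k * n with hz
    have hz0 : 0 < z := sub_pos.2 hwk
    have hyw : z / w * w = z := by field_simp
    set f := √(n ^ 2 + z ^ 2)
    have hf2 : f ^ 2 = n ^ 2 + z ^ 2 := Real.sq_sqrt (by positivity)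
    have hf0 : 0 ≤ f := Real.sqrt_nonneg _
    refine ⟨f, abs_le_of_sq_le_sq' ?_ hf0 |>.2, hcancel hf0 ?_⟩
    · have h1 : d ^ 2 * (n ^ 2 + z ^ 2 - d ^ 2 * (n ^ 2 + w ^ 2)) =
          (1 - d ^ 2) * (d * w - n) ^ 2 := by
        have h2 : d * z = d * w - (1 - d ^ 2) * n := by rw [hz, ← hdk]; ring
        calc _ = d ^ 2 * n ^ 2 + (d * z) ^ 2 - d ^ 4 * (n ^ 2 + w ^ 2) := by ring
          _ = _ := by rw [h2]; ring
      have h3 : 0 ≤ n ^ 2 + z ^ 2 - d ^ 2 * (n ^ 2 + w ^ 2) := by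
        refine nonneg_of_mul_nonneg_right (a := d ^ 2) ?_ (by positivity)
        rw [h1]
        exact mul_nonneg (by nlinarith) (sq_nonneg _)
      rw [mul_pow, hpyth, hf2]
      linarith
    · have h1 := htest (z / w) f (by positivity) hf0 (by rw [hf2, ← mul_pow, hyw])
      have h2 : z / w * w ^ 2 = z * w := by rw [sq, ← mul_assoc, hyw]
      have h3 : z / w * ((1 + δ) * q) ≤ z * (k * n) := by
        calc z / w * ((1 + δ) * q) ≤ z / w * ((1 + d) * (t * (w * n))) := by
              refine mul_le_mul_of_nonneg_left ?_ (by positivity)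
              refine (mul_le_mul_of_nonneg_left hq (by linarith)).trans ?_
              exact mul_le_mul_of_nonneg_right (by linarith) (by positivity)
          _ = z / w * w * (t * (1 + d) * n) := by ring
          _ = z * (k * n) := by rw [hyw]
      rw [h2] at h1
      rw [hf2]
      nlinarith

/-- The two coefficients differ by the factor 2(1+t)/((1+δ)(2+t)), which is at most 2. -/
lemma condition_number_gap_le {t δ e : ℝ} (ht : 0 < t) (hδ0 : 0 ≤ δ) (hδ : δ < 1 / (1 + t))
    (he : 0 ≤ e) :
    ((1 - δ) / (1 + δ) - t / (2 + t)) * e ≤ 2 * ((1 / (1 + t) - δ) * e) := by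
  rw [← mul_assoc]
  refine mul_le_mul_of_nonneg_right ?_ he
  have h1 : (1 - δ) / (1 + δ) - t / (2 + t) =
      2 * (1 / (1 + t) - δ) * ((1 + t) / ((1 + δ) * (2 + t))) := by
    field_simp
    ring
  rw [h1]
  refine mul_le_of_le_one_right (by linarith) ?_
  rw [div_le_one (by positivity)]
  nlinarith

/-! ### Error bounds for small and for positive σ_r -/

section Bounds

variable {n m r k : ℕ} {A : Fin m → Matrix (Fin n) (Fin n) ℝ} {δ ε : ℝ}
  {Mstar : Matrix (Fin n) (Fin n) ℝ} {w : EuclideanSpace ℝ (Fin m)}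
  {X : Matrix (Fin n) (Fin r) ℝ}

lemma IsSecondOrderCritical.inner_gram_eq_zero
    (h : IsSecondOrderCritical (objective A Mstar w) X) :
    inner ℝ (measurementLin A (X * X.transpose - Mstar) + w)
      (measurementLin A (X * X.transpose)) = 0 := by
  have := h.gradient_eq X
  rw [map_add, inner_add_right] at this
  linarith

lemma error_bound_of_sigma_le (hk : 0 < k) (hkr : k ≤ r) (hRIP : RIP A δ (r + k))
    (hε : 0 < ε) (hw : ‖backProjection A w‖ ≤ ε)
    (h : IsSecondOrderCritical (objective A Mstar w) X) (Z : Matrix (Fin n) (Fin k) ℝ)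
    (hZ : Mstar = Z * Z.transpose) (hσ : sigma X r ≤ √(ε / (1 + δ))) :
    ‖X * X.transpose - Mstar‖ ≤
      (ε * √(r : ℝ) + √(ε ^ 2 * (r : ℝ) + 16 * (1 - δ) * ε * √(r : ℝ) * ‖Mstar‖))
        / (2 * (1 - δ)) := by
  have hδ0 := hRIP.1
  have hδ1 := hRIP.2.1
  obtain ⟨⟨v, hv, hXv⟩, -⟩ := exists_minimal_singular_vector (hk.trans_le hkr) X
  have hσ0 : 0 ≤ sigma X r := LinearMap.singularValues_nonneg _ _
  have hσ2 : (1 + δ) * sigma X r ^ 2 ≤ ε := by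
    have := pow_le_pow_left₀ hσ0 hσ 2
    rw [Real.sq_sqrt (by positivity), le_div_iff₀ (by positivity)] at this
    linarith
  have hcurv (u : Fin n → ℝ) : -(2 * ε * (u ⬝ᵥ u)) ≤
      inner ℝ (measurementLin A (X * X.transpose - Mstar) + w)
        (measurementLin A (Matrix.vecMulVec u u)) := by
    refine le_trans ?_ (h.curvature hRIP (by omega) hv u)
    -- Here u need not be orthogonal to Xv, so the second curvature term doubles the constant to 2ε.
    have hcs : (X.mulVec v ⬝ᵥ u) ^ 2 ≤ (X.mulVec v ⬝ᵥ X.mulVec v) * (u ⬝ᵥ u) := by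
      simpa [dotProduct, sq] using Finset.sum_mul_sq_le_sq_mul_sq Finset.univ (X.mulVec v) u
    have huu : 0 ≤ u ⬝ᵥ u := Finset.sum_nonneg fun i _ => mul_self_nonneg _
    rw [hXv] at hcs ⊢
    nlinarith [mul_le_mul_of_nonneg_right hσ2 huu]
  have hsum : -(2 * ε * (Z.transpose * Z).trace) ≤
      inner ℝ (measurementLin A (X * X.transpose - Mstar) + w) (measurementLin A Mstar) := by
    have hcols : measurementLin A Mstar =
        ∑ i, measurementLin A (Matrix.vecMulVec (fun a => Z a i) fun a => Z a i) := by
      rw [← map_sum, ← mul_transpose_eq_sum_vecMulVec, hZ]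
    have htr : (Z.transpose * Z).trace = ∑ i, (fun a => Z a i) ⬝ᵥ (fun a => Z a i) := rfl
    rw [hcols, inner_sum, htr, Finset.mul_sum, ← Finset.sum_neg_distrib]
    exact Finset.sum_le_sum fun i _ => hcurv _
  have htrace : (Z.transpose * Z).trace ≤ √(r : ℝ) * ‖Mstar‖ := by
    rw [hZ]
    refine (trace_transpose_mul_self_le Z).trans ?_
    gcongr
  set E := X * X.transpose - Mstar with hE
  have hrank : E.rank ≤ r + k := by
    have := rank_mul_add_mul_le X Z X.transpose (-Z.transpose)
    rwa [Matrix.mul_neg, ← sub_eq_add_neg, ← hZ, Fintype.card_fin, Fintype.card_fin] at this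
  have hR := (hRIP.2.2 E hrank).1
  have hnoise := (abs_le.1 (abs_inner_measurement_le A w E)).1
  have hnoise' := mul_le_mul_of_nonneg_right hw (norm_nonneg E)
  have hsplit : inner ℝ (measurementLin A E + w) (measurementLin A E) =
      inner ℝ (measurementLin A E + w) (measurementLin A (X * X.transpose)) -
        inner ℝ (measurementLin A E + w) (measurementLin A Mstar) := by
    rw [← inner_sub_right, ← map_sub]
  rw [h.inner_gram_eq_zero, inner_add_left, real_inner_self_eq_norm_sq] at hsplit
  rw [← measurementLin_apply] at hR
  have hr1 : 1 ≤ √(r : ℝ) := by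
    rw [Real.one_le_sqrt]
    exact_mod_cast hk.trans_le hkr
  have hfin := le_quadratic_root_bound (a := 1 - δ) (s := √(r : ℝ)) (by linarith) hε.le hr1
    (norm_nonneg Mstar) (norm_nonneg E)
    (by nlinarith [mul_le_mul_of_nonneg_left htrace hε.le])
  rwa [Real.sq_sqrt (Nat.cast_nonneg r)] at hfin

/-- Only full column rank of X matters; the threshold √(ε/(1+δ)) plays no role. -/
lemma error_bound_of_sigma_pos (hk : 0 < k) (hkr : k ≤ r) (hRIP : RIP A δ (r + k))
    (hδ : δ < 1 / (1 + √((k : ℝ) / (r : ℝ)))) (hε : 0 < ε) (hw : ‖backProjection A w‖ ≤ ε)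
    (h : IsSecondOrderCritical (objective A Mstar w) X) (Z : Matrix (Fin n) (Fin k) ℝ)
    (hZ : Mstar = Z * Z.transpose) (hσ : 0 < sigma X r) :
    (1 / (1 + √((k : ℝ) / (r : ℝ))) - δ) * ‖X * X.transpose - Mstar‖ ≤ ε := by
  have hδ0 := hRIP.1
  obtain ⟨⟨v, hv, hXv⟩, hmin⟩ := exists_minimal_singular_vector (hk.trans_le hkr) X
  set l := sigma X r ^ 2 with hl
  have hl0 : 0 < l := by positivity
  obtain ⟨R, Y, d, hZY, hXY, hYY, hd⟩ := exists_normal_decomposition X (isUnit_det_gram hl0 hmin) Z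
  rw [← hZ] at hZY
  set E := X * X.transpose - Mstar with hE
  set W := Y * Y.transpose with hW
  set N := E + W with hN
  set S := ∑ i, d i with hS
  have hS0 : 0 ≤ S := Finset.sum_nonneg fun i _ => hd i
  have hWnorm : ‖W‖ ^ 2 = ∑ i, d i ^ 2 := frobenius_sq_mul_transpose_diagonal hYY
  have hYX := transpose_mul_eq_zero_comm hXY
  -- the tangent part has the form `X Vᵀ + V Xᵀ`
  obtain ⟨V, hV⟩ : ∃ V : Matrix (Fin n) (Fin r) ℝ, N = X * V.transpose + V * X.transpose := by
    -- Half of X(1 − RRᵀ) produces the symmetric block, −YRᵀ the cross blocks.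
    refine ⟨(1 / 2 : ℝ) • X - (1 / 2 : ℝ) • (X * (R * R.transpose)) - Y * R.transpose, ?_⟩
    rw [hN, hE, hW, hZY]
    simp only [Matrix.transpose_sub, Matrix.transpose_smul, Matrix.transpose_mul,
      Matrix.transpose_add, Matrix.transpose_transpose, Matrix.mul_sub, Matrix.sub_mul,
      Matrix.mul_smul, Matrix.smul_mul, Matrix.mul_add, Matrix.add_mul, Matrix.mul_assoc]
    module
  have hNW : (N.transpose * W).trace = 0 := by
    have h1 : N.transpose * W = X * V.transpose * W := by
      have : X.transpose * W = 0 := by rw [hW, ← Matrix.mul_assoc, hXY, Matrix.zero_mul]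
      rw [hV]
      simp only [Matrix.transpose_add, Matrix.transpose_mul, Matrix.transpose_transpose,
        Matrix.add_mul, Matrix.mul_assoc, this, Matrix.mul_zero, zero_add]
    have h2 : W * X = 0 := by rw [hW, Matrix.mul_assoc, hYX, Matrix.mul_zero]
    rw [h1, Matrix.trace_mul_comm, ← Matrix.mul_assoc, h2, Matrix.zero_mul, Matrix.trace_zero]
  have hpyth (y : ℝ) : ‖N - y • W‖ ^ 2 = ‖N‖ ^ 2 + y ^ 2 * ‖W‖ ^ 2 := by
    have := frobenius_sq_add_smul N W 1 (-y)
    rw [hNW] at this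
    simpa [sub_eq_add_neg] using this
  have hEN : E = N - (1 : ℝ) • W := by rw [hN]; simp
  have hbound (μ : ℝ) (hμ0 : 0 ≤ μ) (hμ : μ ≤ l) (hμS : μ * S ≤ ‖W‖ ^ 2) :
      μ * S ≤ √((k : ℝ) / (r : ℝ)) * (‖W‖ * ‖N‖) := by
    have hb := normal_part_bound R hXY hYY hd (by simpa using hkr) hμ0
      (fun x => (mul_le_mul_of_nonneg_right hμ
        (Finset.sum_nonneg fun i _ => mul_self_nonneg _)).trans (hmin x)) (hWnorm ▸ hμS)
    rw [← hZY] at hb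
    simp only [Fintype.card_fin] at hb
    refine abs_le_of_sq_le_sq' ?_ (by positivity) |>.2
    have hr0 : (0 : ℝ) < r := by exact_mod_cast hk.trans_le hkr
    rw [mul_pow, mul_pow, Real.sq_sqrt (by positivity), div_mul_eq_mul_div, le_div_iff₀ hr0]
    linarith
  have hgrad : inner ℝ (measurementLin A E + w) (measurementLin A N) = 0 := by
    rw [hV]
    exact h.gradient_eq V
  have hcurv : -((1 + δ) * (l * S)) ≤ inner ℝ (measurementLin A E + w) (measurementLin A W) := by
    conv_rhs => rw [hW, mul_transpose_eq_sum_vecMulVec, map_sum, inner_sum]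
    rw [hS, Finset.mul_sum, Finset.mul_sum, ← Finset.sum_neg_distrib]
    refine Finset.sum_le_sum fun i _ => ?_
    have hc := h.curvature hRIP (by omega) hv fun a => Y a i
    have h1 : (fun a => Y a i) ⬝ᵥ (fun a => Y a i) = d i := by
      have := congrFun (congrFun hYY i) i
      rwa [Matrix.diagonal_apply_eq] at this
    -- Columns of Y are orthogonal to the range of X, so no doubling occurs here.
    have h2 : X.mulVec v ⬝ᵥ (fun a => Y a i) = 0 := by
      have h3 : Matrix.vecMul (fun a => Y a i) X = 0 := by
        funext j
        exact congrFun (congrFun hYX i) j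
      rw [dotProduct_comm, Matrix.dotProduct_mulVec, h3, zero_dotProduct]
    rw [hXv, h1, h2] at hc
    simpa only [ne_eq, OfNat.ofNat_ne_zero, not_false_eq_true, zero_pow, add_zero] using hc
  have ht : 0 < √((k : ℝ) / (r : ℝ)) := by
    have hk0 : (0 : ℝ) < k := by exact_mod_cast hk
    have hr0 : (0 : ℝ) < r := by exact_mod_cast hk.trans_le hkr
    positivity
  refine residual_le_of_test_family (n := ‖N‖) (w := ‖W‖) (q := l * S) (norm_nonneg _)
    (norm_nonneg _) (norm_nonneg _) ht hδ0 hδ hε.le ?_ (hbound l hl0.le le_rfl) ?_ ?_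
  · conv_lhs => rw [hEN]
    rw [hpyth]
    ring
  · intro hlt
    have hSpos : 0 < S := by
      refine hS0.lt_of_ne fun h0 => ?_
      rw [← h0, mul_zero] at hlt
      exact absurd hlt (not_lt.2 (sq_nonneg _))
    -- μ is lowered from σ² to the largest value with μ tr W ≤ ‖W‖².
    have hμ := hbound (‖W‖ ^ 2 / S) (by positivity) (by rw [div_le_iff₀ hSpos]; exact hlt.le)
      (by rw [div_mul_cancel₀ _ hSpos.ne'])
    rw [div_mul_cancel₀ _ hSpos.ne'] at hμ
    rcases (norm_nonneg W).eq_or_lt with h0 | h0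
    · rw [← h0]; positivity
    · refine le_of_mul_le_mul_left ?_ h0
      linarith
  · intro y f hy hf hf2
    set F := N - y • W with hF
    have hFf : ‖F‖ = f := by
      rw [← sq_eq_sq₀ (norm_nonneg _) hf, hF, hpyth, hf2]
    have hEF : (E.transpose * F).trace = ‖N‖ ^ 2 + y * ‖W‖ ^ 2 := by
      have hWN : (W.transpose * N).trace = 0 := by
        rw [← hNW, ← Matrix.trace_transpose (W.transpose * N)]
        simp
      rw [hEN, hF, frobenius_sq_eq_trace, frobenius_sq_eq_trace]
      simp only [one_smul, Matrix.transpose_sub, Matrix.sub_mul, Matrix.mul_sub, Matrix.mul_smul,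
        Matrix.trace_sub, Matrix.trace_smul, hNW, hWN, smul_eq_mul]
      ring
    have hrank (a b : ℝ) : (a • E + b • F).rank ≤ r + k := by
      -- Every combination factors through the columns of X and Y, r + k in all.
      have hform : a • E + b • F =
          X * ((a + b) • X.transpose - (a + b) • (R * (X * R + Y).transpose)) +
          Y * (- ((a + b) • (X * R + Y).transpose) + (b * (1 - y)) • Y.transpose) := by
        rw [hF, hN, hE, hW, hZY]
        simp only [Matrix.mul_add, Matrix.mul_sub, Matrix.add_mul, Matrix.mul_smul,
          Matrix.mul_neg, Matrix.mul_assoc]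
        module
      rw [hform]
      simpa using rank_mul_add_mul_le X Y _ _
    have hpol := hRIP.inner_ge E F hrank
    have hnoise := (abs_le.1 (abs_inner_measurement_le A w F)).1
    have hnoise' := mul_le_mul_of_nonneg_right hw (norm_nonneg F)
    have hres : inner ℝ (measurementLin A E + w) (measurementLin A F) =
        - (y * inner ℝ (measurementLin A E + w) (measurementLin A W)) := by
      rw [hF, map_sub _ N, map_smul, inner_sub_right, inner_smul_right, hgrad, zero_sub]
    rw [inner_add_left] at hres
    rw [hEF, hFf] at hpol
    rw [hFf] at hnoise hnoise'
    nlinarith [mul_le_mul_of_nonneg_left hcurv hy]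

end Bounds

end MatrixSensing

theorem theorem2 {n m r rstar : ℕ} (hrstar : 0 < rstar) (hr : rstar ≤ r)
    (A : Fin m → Matrix (Fin n) (Fin n) ℝ)
    (Mstar : Matrix (Fin n) (Fin n) ℝ) (hMstar : Mstar.PosSemidef) (hrank : Mstar.rank = rstar)
    (δ : ℝ) (hRIP : MatrixSensing.RIP A δ (r + rstar))
    (hδ : δ < 1 / (1 + √((rstar : ℝ) / (r : ℝ))))
    (ε : ℝ) (hε : 0 < ε) :
    -- for every realization of the noise with `‖𝐀ᵀ w‖ ≤ ε`
    (∀ w : EuclideanSpace ℝ (Fin m), ‖MatrixSensing.backProjection A w‖ ≤ ε →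
      ∀ X : Matrix (Fin n) (Fin r) ℝ,
        MatrixSensing.IsSecondOrderCritical (MatrixSensing.objective A Mstar w) X →
          MatrixSensing.ErrorBounds Mstar rstar δ ε X) ∧
    -- for random noise, simultaneously at all second-order critical points
    (∀ {Ω : Type*} [MeasurableSpace Ω] (P : Measure Ω) [IsProbabilityMeasure P]
      (w : Ω → EuclideanSpace ℝ (Fin m)), Measurable w →
      P {ω | ‖MatrixSensing.backProjection A (w ω)‖ ≤ ε} ≤
        P {ω | ∀ X : Matrix (Fin n) (Fin r) ℝ,
          MatrixSensing.IsSecondOrderCritical (MatrixSensing.objective A Mstar (w ω)) X →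
            MatrixSensing.ErrorBounds Mstar rstar δ ε X}) := by
  have hmain : ∀ w : EuclideanSpace ℝ (Fin m), ‖MatrixSensing.backProjection A w‖ ≤ ε →
      ∀ X : Matrix (Fin n) (Fin r) ℝ,
        MatrixSensing.IsSecondOrderCritical (MatrixSensing.objective A Mstar w) X →
          MatrixSensing.ErrorBounds Mstar rstar δ ε X := by
    intro w hw X hX
    obtain ⟨Z, hZ⟩ := MatrixSensing.exists_factorization hMstar hrank
    refine ⟨MatrixSensing.error_bound_of_sigma_le hrstar hr hRIP hε hw hX Z hZ, fun hσ => ?_⟩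
    have hbound := MatrixSensing.error_bound_of_sigma_pos hrstar hr hRIP hδ hε hw hX Z hZ
      ((Real.sqrt_nonneg _).trans_lt hσ)
    have hr0 : (0 : ℝ) < r := by exact_mod_cast hrstar.trans_le hr
    have ht : 0 < √((rstar : ℝ) / (r : ℝ)) := by positivity
    have hgap := MatrixSensing.condition_number_gap_le ht hRIP.1 hδ
      (norm_nonneg (X * X.transpose - Mstar))
    -- The bound obtained is 2ε; the factor √r⋆ and the square-root terms only enlarge the right
    -- side.
    have h1 : 1 ≤ √(rstar : ℝ) := by
      rw [Real.one_le_sqrt]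
      exact_mod_cast hrstar
    have h2 : 0 ≤ 2 * √(2 * ε * (1 + δ)) * (√‖X * X.transpose - Mstar‖ + √‖Mstar‖) := by
      positivity
    nlinarith
  exact ⟨hmain, fun P _ w _ => measure_mono fun ω hω => hmain (w ω) hω⟩
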